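/- **Theorem 6 (Fourman–Hyland).** Work in the topological model over $\mathbb C$, that is, in the Heyting-valued universe of sets over the frame of open subsets of $\mathbb C$; an open set $U$ forces a statement $\varphi$, written $U\Vdash\varphi$, if $U$ is contained in the truth value of $\varphi$. Complex numbers of the model are pairs of (two-sided Dedekind) real numbers of the model, and polynomials of the model are finite sequences of such complex numbers (the coefficients). Here "every polynomial has a root" means: every monic polynomial of positive degree with complex coefficients has a complex root. Let $G$ be the generic complex number of the model, whose real part has the truth value of $q<\operatorname{Re}G$ (for $q\in\mathbb Q$) equal to $\{w\in\mathbb C : q<\operatorname{Re}w\}$, that of $\operatorname{Re}G<q$ equal to $\{w\in\mathbb C : \operatorname{Re}w<q\}$, and similarly for the imaginary part. Then: 1. $\mathbb C\Vdash$ "not every polynomial has a root". 2. No non-empty open set forces "every polynomial has a root". 3. $\mathbb C\Vdash$ "$G$ is a complex number", and $O\Vdash G\in O$ for every open $O\subseteq\mathbb C$, where in the model $O$ is interpreted as the union of the open rectangles with rational vertices that are contained in $O$. 4. $X^2-G$ is forced by $\mathbb C$ to be a monic polynomial of degree $2$, and no open neighbourhood of $0$ forces "$X^2-G$ has a root". 5.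 More generally, for every $v\in\mathbb C$, $X^2-(G-v)$ is forced by $\mathbb C$ to be a monic polynomial of degree $2$, and no open neighbourhood of $v$ forces "$X^2-(G-v)$ has a root". -/

import Mathlib

open TopologicalSpace

noncomputable section

namespace TopModel

/-! ### The Heyting-valued universe of sets over a frame `H`

For `H = Opens T` this is the (full) topological model over the space `T`.  Formulas of set theory
are evaluated in `H` in the usual way: conjunction is `⊓`, disjunction is `⊔`, implication is `⇨`,
negation is `ᶜ`, the quantifiers `∀`, `∃` over all sets are `⨅`, `⨆` over all names, and a
quantifier bounded by a ground-model set is `⨅` or `⨆` over the elements of that set. -/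

/-- A name (term): a family of pairs `⟨p i, σ i⟩` of a truth value and a name. -/
inductive Name (H : Type) : Type 1
  | mk (ι : Type) (σ : ι → Name H) (p : ι → H) : Name H

variable {H : Type} [Order.Frame H]

/-- The truth value of `a = b` (extensional equality). -/
def eq : Name H → Name H → H
  | Name.mk ι σ p, Name.mk κ τ q =>
    (⨅ i : ι, p i ⇨ ⨆ j : κ, q j ⊓ eq (σ i) (τ j)) ⊓
    (⨅ j : κ, q j ⇨ ⨆ i : ι, p i ⊓ eq (σ i) (τ j))

/-- The truth value of `a ∈ b`. -/
def mem (a : Name H) : Name H → H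
  | Name.mk κ τ q => ⨆ j : κ, q j ⊓ eq a (τ j)

/-- The truth value of `a ⊆ b`. -/
def sub (a b : Name H) : H := ⨅ x : Name H, mem x a ⇨ mem x b

/-- The embedding of the ground model into the names. -/
def hat : PSet.{0} → Name H
  | PSet.mk ι A => Name.mk ι (fun i => hat (A i)) (fun _ => ⊤)

/-- The unordered pair `{a, b}`. -/
def upair (a b : Name H) : Name H := Name.mk Bool (fun i => cond i a b) (fun _ => ⊤)

/-- The Kuratowski ordered pair `(a, b) = {{a}, {a, b}}`. -/
def opair (a b : Name H) : Name H := upair (upair a a) (upair a b)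

/-- The natural number `n` (a von Neumann numeral) in the model. -/
def nat (n : ℕ) : Name H := hat (PSet.ofNat n)

/-- The rational number `q` in the model.  Rationals are represented as sets through an injective
coding by natural numbers. -/
def rat (q : ℚ) : Name H := nat (Encodable.encode q)

/-- The set `{q ∈ ℚ | φ q}` in the model. -/
def sepRat (φ : ℚ → H) : Name H := Name.mk ℚ rat φ

/-- The set of rational numbers of the model. -/
def ratSet : Name H := sepRat fun _ => ⊤

/-! ### Real and complex numbers of the model -/

/-- `(L, U)` is a (two-sided) Dedekind cut in the rationals: `L` and `U` are sets of rationals,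
inhabited, rounded, disjoint and located. -/
def IsCut (L U : Name H) : H :=
  sub L ratSet ⊓ sub U ratSet ⊓
  (⨆ q : ℚ, mem (rat q) L) ⊓ (⨆ q : ℚ, mem (rat q) U) ⊓
  (⨅ q : ℚ, bihimp (mem (rat q) L) (⨆ r : ℚ, ⨆ _ : q < r, mem (rat r) L)) ⊓
  (⨅ q : ℚ, bihimp (mem (rat q) U) (⨆ r : ℚ, ⨆ _ : r < q, mem (rat r) U)) ⊓
  (⨅ q : ℚ, (mem (rat q) L ⊓ mem (rat q) U)ᶜ) ⊓
  (⨅ q : ℚ, ⨅ r : ℚ, ⨅ _ : q < r, mem (rat q) L ⊔ mem (rat r) U)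

/-- `x` is a real number: an ordered pair forming a Dedekind cut. -/
def IsReal (x : Name H) : H := ⨆ L : Name H, ⨆ U : Name H, eq x (opair L U) ⊓ IsCut L U

/-- `z` is a complex number: an ordered pair of real numbers. -/
def IsComplex (z : Name H) : H :=
  ⨆ x : Name H, ⨆ y : Name H, eq z (opair x y) ⊓ IsReal x ⊓ IsReal y

/-- The truth value of `q < x`, for `x` a real number. -/
def lo (x : Name H) (q : ℚ) : H := ⨆ L : Name H, ⨆ U : Name H, eq x (opair L U) ⊓ mem (rat q) L

/-- The truth value of `x < q`, for `x` a real number. -/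
def up (x : Name H) (q : ℚ) : H := ⨆ L : Name H, ⨆ U : Name H, eq x (opair L U) ⊓ mem (rat q) U

/-- The pair of sets of rationals `({q | φ q}, {q | ψ q})`. -/
def cut (φ ψ : ℚ → H) : Name H := opair (sepRat φ) (sepRat ψ)

/-- The sum of real numbers. -/
def addR (x y : Name H) : Name H :=
  cut (fun q => ⨆ r : ℚ, lo x r ⊓ lo y (q - r)) (fun q => ⨆ r : ℚ, up x r ⊓ up y (q - r))

/-- The negative of a real number. -/
def negR (x : Name H) : Name H := cut (fun q => up x (-q)) (fun q => lo x (-q))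

/-- The product of real numbers: `q < x * y` if `q < s * t` for all `s`, `t` in some rational
intervals around `x` and `y`, and similarly for `x * y < q`. -/
def mulR (x y : Name H) : Name H :=
  cut
    (fun q => ⨆ a : ℚ, ⨆ b : ℚ, ⨆ c : ℚ, ⨆ d : ℚ,
      ⨆ _ : q < min (min (a * c) (a * d)) (min (b * c) (b * d)),
        lo x a ⊓ up x b ⊓ lo y c ⊓ up y d)
    (fun q => ⨆ a : ℚ, ⨆ b : ℚ, ⨆ c : ℚ, ⨆ d : ℚ,
      ⨆ _ : max (max (a * c) (a * d)) (max (b * c) (b * d)) < q,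
        lo x a ⊓ up x b ⊓ lo y c ⊓ up y d)

/-- The real number of the model given by a real number of the ground model. -/
def constR (r : ℝ) : Name H :=
  cut (fun q => ⨆ _ : (q : ℝ) < r, ⊤) (fun q => ⨆ _ : r < (q : ℝ), ⊤)

/-- The real part of a complex number. -/
def re (z : Name H) : Name H :=
  cut (fun q => ⨆ x : Name H, ⨆ y : Name H, eq z (opair x y) ⊓ lo x q)
    (fun q => ⨆ x : Name H, ⨆ y : Name H, eq z (opair x y) ⊓ up x q)

/-- The imaginary part of a complex number. -/
def im (z : Name H) : Name H :=
  cut (fun q => ⨆ x : Name H, ⨆ y : Name H, eq z (opair x y) ⊓ lo y q)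
    (fun q => ⨆ x : Name H, ⨆ y : Name H, eq z (opair x y) ⊓ up y q)

/-- The sum of complex numbers. -/
def addC (z w : Name H) : Name H := opair (addR (re z) (re w)) (addR (im z) (im w))

/-- The negative of a complex number. -/
def negC (z : Name H) : Name H := opair (negR (re z)) (negR (im z))

/-- The product of complex numbers. -/
def mulC (z w : Name H) : Name H :=
  opair (addR (mulR (re z) (re w)) (negR (mulR (im z) (im w))))
    (addR (mulR (re z) (im w)) (mulR (im z) (re w)))

/-- The complex number of the model given by a complex number of the ground model. -/
def constC (c : ℂ) : Name H := opair (constR c.re) (constR c.im)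

/-- The power `z ^ k` of a complex number. -/
def powC (z : Name H) : ℕ → Name H
  | 0 => constC 1
  | k + 1 => mulC (powC z k) z

/-- The sum `∑ k < m, a k * z ^ k`. -/
def sumC (a : ℕ → Name H) (z : Name H) : ℕ → Name H
  | 0 => constC 0
  | m + 1 => addC (sumC a z m) (mulC (a m) (powC z m))

/-! ### Polynomials of the model

A polynomial of formal degree `n` is its sequence of coefficients, a function from
`{0, …, n}` to the complex numbers. -/

/-- `p` is a function from `{0, …, n}` to the set of complex numbers. -/
def IsPoly (n : ℕ) (p : Name H) : H :=
  (⨅ x : Name H, mem x p ⇨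
    ⨆ k : Fin (n + 1), ⨆ c : Name H, IsComplex c ⊓ eq x (opair (nat k) c)) ⊓
  (⨅ k : Fin (n + 1), ⨆ c : Name H, mem (opair (nat k) c) p) ⊓
  (⨅ k : Fin (n + 1), ⨅ c : Name H, ⨅ d : Name H,
    mem (opair (nat k) c) p ⊓ mem (opair (nat k) d) p ⇨ eq c d)

/-- `p` is a monic polynomial of degree `n`. -/
def IsMonicPoly (n : ℕ) (p : Name H) : H := IsPoly n p ⊓ mem (opair (nat n) (constC 1)) p

/-- `z` is a root of `p`: if `a 0, …, a n` are the coefficients of `p`, then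
`∑ k ≤ n, a k * z ^ k = 0`. -/
def IsRoot (n : ℕ) (p z : Name H) : H :=
  ⨆ a : ℕ → Name H, (⨅ k : Fin (n + 1), mem (opair (nat k) (a k)) p) ⊓
    eq (sumC a z (n + 1)) (constC 0)

/-- `p` (of formal degree `n`) has a root in the complex numbers. -/
def HasRoot (n : ℕ) (p : Name H) : H := ⨆ z : Name H, IsComplex z ⊓ IsRoot n p z

/-- The truth value of: every monic polynomial of positive degree over the complex numbers has
a root in the complex numbers. -/
def EveryPolyHasRoot (H : Type) [Order.Frame H] : H :=
  ⨅ n : ℕ, ⨅ _ : 1 ≤ n, ⨅ p : Name H, IsMonicPoly n p ⇨ HasRoot n p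

/-- The polynomial `X ^ 2 - c`, with coefficients `-c`, `0`, `1`. -/
def sqSub (c : Name H) : Name H :=
  Name.mk (Fin 3) (fun k => opair (nat k) (![negC c, constC 0, constC 1] k)) (fun _ => ⊤)

/-! ### Forcing, and the generic complex number -/

/-- The open set `U` forces a formula with truth value `φ`. -/
def Forces {T : Type} [TopologicalSpace T] (U φ : Opens T) : Prop := U ≤ φ

infix:45 " ⊩ " => Forces

/-- The open set of all `w` with `f w < g w`. -/
def openLt (f g : ℂ → ℝ) (hf : Continuous f) (hg : Continuous g) : Opens ℂ :=
  ⟨{w | f w < g w}, isOpen_lt hf hg⟩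

/-- The generic complex number `G` of the topological model over `ℂ`:
`q < Re G` has truth value `{w | q < Re w}`, and so on. -/
def generic : Name (Opens ℂ) :=
  opair
    (cut (fun q => openLt (fun _ => (q : ℝ)) Complex.re continuous_const Complex.continuous_re)
      (fun q => openLt Complex.re (fun _ => (q : ℝ)) Complex.continuous_re continuous_const))
    (cut (fun q => openLt (fun _ => (q : ℝ)) Complex.im continuous_const Complex.continuous_im)
      (fun q => openLt Complex.im (fun _ => (q : ℝ)) Complex.continuous_im continuous_const))

/-- The truth value of `z ∈ O`, for `z` a complex number of the model and `O` an open set of the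
ground model.  In the model, `O` is interpreted as the union of the open rectangles with rational
vertices that are contained in `O`. -/
def memOpen (z : Name H) (O : Opens ℂ) : H :=
  ⨆ a : ℚ, ⨆ b : ℚ, ⨆ c : ℚ, ⨆ d : ℚ,
    ⨆ _ : ∀ w : ℂ, a < w.re → w.re < b → c < w.im → w.im < d → w ∈ O,
      lo (re z) a ⊓ up (re z) b ⊓ lo (im z) c ⊓ up (im z) d

end TopModel

end

open TopModel

/-!
At a point `w` of the base space, every real or complex number of the model has an ordinary value:
the rationals `q` for which `w` lies in the truth value of `q < x` form the lower half of a Dedekind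
cut. Taking values commutes with the arithmetic of the model, and the value depends continuously
on `w` because the truth values of `q < x` and `x < q` are open. The value of `G` at `w` is `w`, so
a root of `X ^ 2 - (G - v)` forced near `v` would be a continuous branch of `√(w - v)` on a
neighbourhood of `v`. There is none: the square root changes sign along a circle around `v`. Hence
no point `v` lies in the truth value of the assertion that every polynomial has a root.
-/

open scoped Topology

namespace TopModel

section Frame

variable {H : Type} [Order.Frame H]

protected theorem eq_self (a : Name H) : eq a a = ⊤ := by
  induction a with
  | mk ι σ p ih =>
    simp only [eq, inf_eq_top_iff, iInf_eq_top, himp_eq_top_iff]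
    exact ⟨fun i => le_iSup_of_le i (by rw [ih, inf_top_eq]),
      fun i => le_iSup_of_le i (by rw [ih, inf_top_eq])⟩

protected theorem eq_comm (a b : Name H) : eq a b = eq b a := by
  induction a generalizing b with
  | mk ι σ p ih =>
    cases b
    simp only [eq, ih]
    exact inf_comm _ _

theorem mem_mk (a : Name H) {κ : Type} (τ : κ → Name H) (q : κ → H) :
    mem a (Name.mk κ τ q) = ⨆ j, q j ⊓ eq a (τ j) := by
  rw [mem]

theorem eq_mk_mk {ι κ : Type} (σ : ι → Name H) (p : ι → H) (τ : κ → Name H) (q : κ → H) :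
    eq (Name.mk ι σ p) (Name.mk κ τ q) =
      (⨅ i, p i ⇨ mem (σ i) (Name.mk κ τ q)) ⊓ ⨅ j, q j ⇨ mem (τ j) (Name.mk ι σ p) := by
  simp only [eq, mem_mk, TopModel.eq_comm (τ _) (σ _)]

theorem inf_eq_mk_le_mem {ι : Type} (σ : ι → Name H) (p : ι → H) (b : Name H) (i : ι) :
    p i ⊓ eq (Name.mk ι σ p) b ≤ mem (σ i) b := by
  cases b
  rw [eq_mk_mk, ← le_himp_iff']
  exact inf_le_left.trans (iInf_le _ i)

theorem mem_inf_eq_mk_le {κ : Type} {τ : κ → Name H} {q : κ → H}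
    (trans : ∀ j a c, eq a (τ j) ⊓ eq (τ j) c ≤ eq a c) (a b : Name H) :
    mem a (Name.mk κ τ q) ⊓ eq (Name.mk κ τ q) b ≤ mem a b := by
  rw [mem_mk, iSup_inf_eq]
  refine iSup_le fun j => ?_
  calc q j ⊓ eq a (τ j) ⊓ eq (Name.mk κ τ q) b
      = eq a (τ j) ⊓ (q j ⊓ eq (Name.mk κ τ q) b) := by ac_rfl
    _ ≤ eq a (τ j) ⊓ mem (τ j) b := inf_le_inf_left _ (inf_eq_mk_le_mem τ q b j)
    _ ≤ mem a b := by
      cases b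
      simp only [mem_mk, inf_iSup_eq]
      refine iSup_mono fun k => ?_
      rw [inf_left_comm]
      exact inf_le_inf_left _ (trans j _ _)

protected theorem eq_trans (a b c : Name H) : eq a b ⊓ eq b c ≤ eq a c := by
  induction b generalizing a c with
  | mk κ τ q ih =>
    have subset (c : Name H) {ι : Type} (σ : ι → Name H) (p : ι → H) (i : ι) :
        eq (Name.mk ι σ p) (Name.mk κ τ q) ⊓ eq (Name.mk κ τ q) c ≤ p i ⇨ mem (σ i) c := by
      rw [le_himp_iff', ← inf_assoc]
      exact (inf_le_inf_right _ (inf_eq_mk_le_mem σ p _ i)).trans (mem_inf_eq_mk_le ih _ c)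
    cases a with
    | mk ι σ p =>
      cases c with
      | mk l υ r =>
        rw [eq_mk_mk σ p υ r]
        refine le_inf (le_iInf (subset _ σ p)) (le_iInf fun k => ?_)
        rw [inf_comm, TopModel.eq_comm _ (Name.mk l υ r), TopModel.eq_comm (Name.mk ι σ p)]
        exact subset _ υ r k

theorem mem_inf_eq_le_mem (a b c : Name H) : mem a b ⊓ eq b c ≤ mem a c := by
  cases b
  exact mem_inf_eq_mk_le (fun _ a c => TopModel.eq_trans a _ c) a c

theorem mem_upair (x a b : Name H) : mem x (upair a b) = eq x a ⊔ eq x b := by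
  simp only [upair, mem_mk, iSup_bool_eq, cond_true, cond_false, top_inf_eq]

theorem eq_upair_upair (a b c d : Name H) :
    eq (upair a b) (upair c d) =
      (mem a (upair c d) ⊓ mem b (upair c d)) ⊓ (mem c (upair a b) ⊓ mem d (upair a b)) := by
  simp only [upair, eq_mk_mk, top_himp, iInf_bool_eq, cond_true, cond_false]

theorem eq_inf_eq_le_eq_upair (a b c d : Name H) :
    eq a c ⊓ eq b d ≤ eq (upair a b) (upair c d) := by
  simp only [eq_upair_upair, mem_upair, TopModel.eq_comm c, TopModel.eq_comm d]
  exact le_inf (inf_le_inf le_sup_left le_sup_right) (inf_le_inf le_sup_left le_sup_right)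

theorem eq_opair_opair_le_left (a b c d : Name H) : eq (opair a b) (opair c d) ≤ eq a c := by
  have of_singleton (x : Name H) : eq (upair a a) (upair c x) ≤ eq a c := by
    rw [eq_upair_upair, mem_upair c, sup_idem, TopModel.eq_comm c]
    exact inf_le_right.trans inf_le_left
  rw [opair, opair, eq_upair_upair, mem_upair (upair a a)]
  exact (inf_le_left.trans inf_le_left).trans (sup_le (of_singleton c) (of_singleton d))

theorem eq_opair_opair_le_right (a b c d : Name H) :
    eq (opair a b) (opair c d) ≤ eq b c ⊔ eq b d := by
  have of_pair (x : Name H) : eq (upair a b) (upair c x) ≤ eq b c ⊔ eq b x := by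
    rw [eq_upair_upair, mem_upair b]
    exact inf_le_left.trans inf_le_right
  rw [opair, opair, eq_upair_upair, mem_upair (upair a b)]
  refine (inf_le_left.trans inf_le_right).trans (sup_le ?_ (of_pair d))
  exact (of_pair c).trans (sup_le le_sup_left le_sup_left)

theorem eq_opair_opair (a b c d : Name H) :
    eq (opair a b) (opair c d) = eq a c ⊓ eq b d := by
  apply le_antisymm
  · have hac := eq_opair_opair_le_left a b c d
    have hb := eq_opair_opair_le_right a b c d
    have hd := eq_opair_opair_le_right c d a b
    rw [TopModel.eq_comm (opair c d), TopModel.eq_comm d, TopModel.eq_comm d] at hd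
    have hbd : eq b c ⊓ (eq a c ⊓ eq a d) ≤ eq b d :=
      calc eq b c ⊓ (eq a c ⊓ eq a d)
          = eq b c ⊓ eq c a ⊓ eq a d := by rw [TopModel.eq_comm a c, inf_assoc]
        _ ≤ eq b a ⊓ eq a d := inf_le_inf_right _ (TopModel.eq_trans b c a)
        _ ≤ eq b d := TopModel.eq_trans b a d
    refine le_inf hac ((le_inf hb (le_inf hac hd)).trans ?_)
    rw [inf_sup_right, inf_sup_left (eq a c), inf_sup_left (eq b c)]
    exact sup_le (sup_le hbd (inf_le_right.trans inf_le_right)) inf_le_left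
  · refine le_trans (le_inf ?_ ?_) (eq_inf_eq_le_eq_upair _ _ _ _)
    · exact (le_inf inf_le_left inf_le_left).trans (eq_inf_eq_le_eq_upair a a c c)
    · exact eq_inf_eq_le_eq_upair a b c d

theorem iSup_eq_opair_inf {F : Name H → Name H → H} {a b : Name H}
    (hF : ∀ c d, eq a c ⊓ eq b d ⊓ F c d ≤ F a b) :
    ⨆ c, ⨆ d, eq (opair a b) (opair c d) ⊓ F c d = F a b := by
  refine le_antisymm (iSup₂_le fun c d => ?_) (le_iSup₂_of_le a b ?_)
  · rw [eq_opair_opair]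
    exact hF c d
  · rw [TopModel.eq_self, top_inf_eq]

theorem eq_hat_of_not_equiv {x y : PSet.{0}} (h : ¬ PSet.Equiv x y) :
    eq (hat x : Name H) (hat y) = ⊥ := by
  induction x generalizing y with
  | mk ι A ih =>
    cases y with
    | mk κ B =>
      simp only [hat, eq, top_himp, top_inf_eq]
      rw [eq_bot_iff]
      rcases not_and_or.1 h with h | h
      · obtain ⟨i, hi⟩ := not_forall.1 h
        refine inf_le_left.trans ((iInf_le _ i).trans (iSup_le fun j => ?_))
        exact (ih i (not_exists.1 hi j)).le
      · obtain ⟨j, hj⟩ := not_forall.1 h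
        refine inf_le_right.trans ((iInf_le _ j).trans (iSup_le fun i => ?_))
        exact (ih i (not_exists.1 hj i)).le

theorem rank_ofNat (n : ℕ) : (PSet.ofNat.{0} n).rank = n := by
  induction n with
  | zero => exact PSet.rank_empty
  | succ n ih =>
    rw [PSet.ofNat, PSet.rank_insert, ih, max_eq_left (Order.le_succ _), Nat.cast_succ,
      Order.succ_eq_add_one]

theorem eq_nat_of_ne {m n : ℕ} (h : m ≠ n) : eq (nat m : Name H) (nat n) = ⊥ := by
  refine eq_hat_of_not_equiv fun hmn => h ?_
  have := PSet.rank_congr hmn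
  rwa [rank_ofNat, rank_ofNat, Nat.cast_inj] at this

theorem eq_rat_of_ne {q r : ℚ} (h : q ≠ r) : eq (rat q : Name H) (rat r) = ⊥ :=
  eq_nat_of_ne (Encodable.encode_injective.ne h)

theorem mem_rat_sepRat (q : ℚ) (φ : ℚ → H) : mem (rat q) (sepRat φ) = φ q := by
  rw [sepRat, mem_mk]
  refine le_antisymm (iSup_le fun r => ?_) (le_iSup_of_le q ?_)
  · obtain rfl | h := eq_or_ne q r
    · exact inf_le_left
    · rw [eq_rat_of_ne h, inf_bot_eq]
      exact bot_le
  · rw [TopModel.eq_self, inf_top_eq]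

theorem sub_sepRat_ratSet (φ : ℚ → H) : sub (sepRat φ) ratSet = ⊤ := by
  simp only [sub, iInf_eq_top, himp_eq_top_iff, ratSet, sepRat, mem_mk]
  exact fun x => iSup_mono fun q => inf_le_inf_right _ le_top

theorem lo_opair (L U : Name H) (q : ℚ) : lo (opair L U) q = mem (rat q) L :=
  iSup_eq_opair_inf fun c d => by
    rw [inf_right_comm, inf_comm (eq L c), TopModel.eq_comm]
    exact inf_le_left.trans (mem_inf_eq_le_mem _ _ _)

theorem up_opair (L U : Name H) (q : ℚ) : up (opair L U) q = mem (rat q) U :=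
  iSup_eq_opair_inf fun c d => by
    rw [inf_assoc, inf_comm (eq U d), TopModel.eq_comm U]
    exact inf_le_right.trans (mem_inf_eq_le_mem _ _ _)

theorem lo_cut (φ ψ : ℚ → H) (q : ℚ) : lo (cut φ ψ) q = φ q := by
  rw [cut, lo_opair, mem_rat_sepRat]

theorem up_cut (φ ψ : ℚ → H) (q : ℚ) : up (cut φ ψ) q = ψ q := by
  rw [cut, up_opair, mem_rat_sepRat]

theorem eq_inf_iSup_opair_le (F : Name H → Name H → H) (x y : Name H) :
    eq x y ⊓ ⨆ a, ⨆ b, eq x (opair a b) ⊓ F a b ≤ ⨆ a, ⨆ b, eq y (opair a b) ⊓ F a b := by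
  simp only [inf_iSup_eq]
  refine iSup₂_mono fun a b => ?_
  rw [← inf_assoc, TopModel.eq_comm x y]
  exact inf_le_inf_right _ (TopModel.eq_trans y x _)

theorem eq_inf_lo_le_lo (x y : Name H) (q : ℚ) : eq x y ⊓ lo x q ≤ lo y q :=
  eq_inf_iSup_opair_le _ x y

theorem eq_inf_up_le_up (x y : Name H) (q : ℚ) : eq x y ⊓ up x q ≤ up y q :=
  eq_inf_iSup_opair_le _ x y

theorem lo_re_opair (x y : Name H) (q : ℚ) : lo (re (opair x y)) q = lo x q :=
  (lo_cut _ _ q).trans <| iSup_eq_opair_inf (F := fun x _ => lo x q) fun c d => by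
    rw [TopModel.eq_comm x]
    exact (inf_le_inf_right _ inf_le_left).trans (eq_inf_lo_le_lo c x q)

theorem up_re_opair (x y : Name H) (q : ℚ) : up (re (opair x y)) q = up x q :=
  (up_cut _ _ q).trans <| iSup_eq_opair_inf (F := fun x _ => up x q) fun c d => by
    rw [TopModel.eq_comm x]
    exact (inf_le_inf_right _ inf_le_left).trans (eq_inf_up_le_up c x q)

theorem lo_im_opair (x y : Name H) (q : ℚ) : lo (im (opair x y)) q = lo y q :=
  (lo_cut _ _ q).trans <| iSup_eq_opair_inf (F := fun _ y => lo y q) fun c d => by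
    rw [TopModel.eq_comm y]
    exact (inf_le_inf_right _ inf_le_right).trans (eq_inf_lo_le_lo d y q)

theorem up_im_opair (x y : Name H) (q : ℚ) : up (im (opair x y)) q = up y q :=
  (up_cut _ _ q).trans <| iSup_eq_opair_inf (F := fun _ y => up y q) fun c d => by
    rw [TopModel.eq_comm y]
    exact (inf_le_inf_right _ inf_le_right).trans (eq_inf_up_le_up d y q)

theorem le_isComplex_opair {a : H} {x y : Name H} (hx : a ≤ IsReal x) (hy : a ≤ IsReal y) :
    a ≤ IsComplex (opair x y) :=
  le_iSup₂_of_le x y <| le_inf (le_inf (by rw [TopModel.eq_self]; exact le_top) hx) hy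

/-- The polynomial of formal degree `n` whose coefficients are the names `a 0, …, a n`. -/
def poly {n : ℕ} (a : Fin (n + 1) → Name H) : Name H :=
  Name.mk (Fin (n + 1)) (fun k => opair (nat k) (a k)) fun _ => ⊤

theorem mem_opair_nat_poly {n : ℕ} (a : Fin (n + 1) → Name H) (k : Fin (n + 1)) (x : Name H) :
    mem (opair (nat k) x) (poly a) = eq x (a k) := by
  simp only [poly, mem_mk, top_inf_eq, eq_opair_opair]
  refine le_antisymm (iSup_le fun j => ?_) (le_iSup_of_le k ?_)
  · obtain rfl | h := eq_or_ne k j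
    · exact inf_le_right
    · rw [eq_nat_of_ne (Fin.val_ne_of_ne h), bot_inf_eq]
      exact bot_le
  · rw [TopModel.eq_self, top_inf_eq]

theorem iInf_isComplex_le_isPoly_poly {n : ℕ} (a : Fin (n + 1) → Name H) :
    ⨅ k, IsComplex (a k) ≤ IsPoly n (poly a) := by
  refine le_inf (le_inf (le_iInf fun x => ?values) (le_iInf fun k => ?total))
    (le_iInf fun k => le_iInf fun c => le_iInf fun d => ?functional)
  case values =>
    rw [le_himp_iff, poly, mem_mk, inf_iSup_eq]
    exact iSup_mono fun k => le_iSup_of_le (a k) (inf_le_inf (iInf_le _ k) inf_le_right)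
  case total =>
    refine le_iSup_of_le (a k) ?_
    rw [mem_opair_nat_poly, TopModel.eq_self]
    exact le_top
  case functional =>
    rw [le_himp_iff, mem_opair_nat_poly, mem_opair_nat_poly, TopModel.eq_comm d]
    exact inf_le_right.trans (TopModel.eq_trans _ _ _)

theorem everyPolyHasRoot_le_himp {n : ℕ} (hn : 1 ≤ n) (p : Name H) :
    EveryPolyHasRoot H ≤ IsMonicPoly n p ⇨ HasRoot n p :=
  (iInf_le _ n).trans ((iInf_le _ hn).trans (iInf_le _ p))

end Frame

section DedekindCut

/-- The inhabited, rounded, disjoint and located pairs of sets of rationals in the ground model: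
the property that `IsCut` expresses inside the topological model. -/
structure IsDedekindCut (L U : Set ℚ) : Prop where
  nonempty_lower : L.Nonempty
  nonempty_upper : U.Nonempty
  mem_lower_iff : ∀ q, q ∈ L ↔ ∃ r, q < r ∧ r ∈ L
  mem_upper_iff : ∀ q, q ∈ U ↔ ∃ r, r < q ∧ r ∈ U
  disjoint : Disjoint L U
  located : ∀ q r, q < r → q ∈ L ∨ r ∈ U

variable {L U : Set ℚ}

theorem IsDedekindCut.le_of_mem_of_mem (h : IsDedekindCut L U) {q r : ℚ} (hq : q ∈ L)
    (hr : r ∈ U) : q ≤ r :=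
  le_of_not_gt fun hrq => Set.disjoint_left.1 h.disjoint hq ((h.mem_upper_iff q).2 ⟨r, hrq, hr⟩)

theorem IsDedekindCut.exists_real (h : IsDedekindCut L U) :
    ∃ x : ℝ, ∀ q : ℚ, (q ∈ L ↔ (q : ℝ) < x) ∧ (q ∈ U ↔ x < q) := by
  have upper_bound {r : ℚ} (hr : r ∈ U) : (r : ℝ) ∈ upperBounds ((↑) '' L : Set ℝ) :=
    Set.forall_mem_image.2 fun _ hq => by exact_mod_cast h.le_of_mem_of_mem hq hr
  have hne : ((↑) '' L : Set ℝ).Nonempty := h.nonempty_lower.image _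
  have hlub := isLUB_csSup hne (h.nonempty_upper.imp' _ fun _ => upper_bound)
  refine ⟨sSup ((↑) '' L), fun q => ⟨⟨fun hq => ?_, fun hq => ?_⟩, ⟨fun hq => ?_, fun hq => ?_⟩⟩⟩
  · obtain ⟨r, hqr, hr⟩ := (h.mem_lower_iff q).1 hq
    exact (Rat.cast_lt.2 hqr).trans_le (hlub.1 ⟨r, hr, rfl⟩)
  · obtain ⟨_, ⟨r, hr, rfl⟩, hqr⟩ := (lt_isLUB_iff hlub).1 hq
    exact (h.mem_lower_iff q).2 ⟨r, Rat.cast_lt.1 hqr, hr⟩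
  · obtain ⟨r, hrq, hr⟩ := (h.mem_upper_iff q).1 hq
    exact (hlub.2 (upper_bound hr)).trans_lt (Rat.cast_lt.2 hrq)
  · obtain ⟨r, hr, hrq⟩ := exists_rat_btwn hq
    exact (h.located r q (Rat.cast_lt.1 hrq)).resolve_left
      fun hrL => hr.not_ge (hlub.1 ⟨r, hrL, rfl⟩)

theorem isDedekindCut_of_real {x : ℝ} (hL : ∀ q : ℚ, q ∈ L ↔ (q : ℝ) < x)
    (hU : ∀ q : ℚ, q ∈ U ↔ x < q) : IsDedekindCut L U where
  nonempty_lower := (exists_rat_lt x).imp fun q => (hL q).2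
  nonempty_upper := (exists_rat_gt x).imp fun q => (hU q).2
  mem_lower_iff q := by
    simp only [hL]
    refine ⟨fun h => ?_, fun ⟨r, hqr, hr⟩ => (Rat.cast_lt.2 hqr).trans hr⟩
    obtain ⟨r, hqr, hr⟩ := exists_rat_btwn h
    exact ⟨r, Rat.cast_lt.1 hqr, hr⟩
  mem_upper_iff q := by
    simp only [hU]
    refine ⟨fun h => ?_, fun ⟨r, hrq, hr⟩ => hr.trans (Rat.cast_lt.2 hrq)⟩
    obtain ⟨r, hr, hrq⟩ := exists_rat_btwn h
    exact ⟨r, Rat.cast_lt.1 hrq, hr⟩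
  disjoint := Set.disjoint_left.2 fun q hqL hqU => lt_asymm ((hL q).1 hqL) ((hU q).1 hqU)
  located q r hqr := by
    rw [hL, hU]
    exact (lt_or_ge (q : ℝ) x).imp_right fun h => h.trans_lt (Rat.cast_lt.2 hqr)

end DedekindCut

section RationalRectangle

theorem exists_rat_Icc_subset_of_mem_nhds {S : Set ℝ} {r : ℝ} (h : S ∈ 𝓝 r) :
    ∃ a b : ℚ, a < r ∧ r < b ∧ Set.Icc (a : ℝ) b ⊆ S := by
  obtain ⟨l, u, ⟨hl, hu⟩, hS⟩ := mem_nhds_iff_exists_Ioo_subset.1 h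
  obtain ⟨a, hla, har⟩ := exists_rat_btwn hl
  obtain ⟨b, hrb, hbu⟩ := exists_rat_btwn hu
  exact ⟨a, b, har, hrb, fun x hx => hS ⟨hla.trans_le hx.1, hx.2.trans_lt hbu⟩⟩

theorem exists_rat_rectangle_subset_of_mem_nhds {S : Set (ℝ × ℝ)} {r s : ℝ} (h : S ∈ 𝓝 (r, s)) :
    ∃ a b c d : ℚ, a < r ∧ r < b ∧ c < s ∧ s < d ∧
      Set.Icc (a : ℝ) b ×ˢ Set.Icc (c : ℝ) d ⊆ S := by
  obtain ⟨A, hA, B, hB, hS⟩ := mem_nhds_prod_iff.1 h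
  obtain ⟨a, b, ha, hb, habA⟩ := exists_rat_Icc_subset_of_mem_nhds hA
  obtain ⟨c, d, hc, hd, hcdB⟩ := exists_rat_Icc_subset_of_mem_nhds hB
  exact ⟨a, b, c, d, ha, hb, hc, hd, (Set.prod_mono habA hcdB).trans hS⟩

variable {K : Type*} [CommRing K] [LinearOrder K] [IsStrictOrderedRing K] {a b c d r s : K}

theorem min_mul_le_mul (hr : r ∈ Set.Icc a b) (s : K) : min (a * s) (b * s) ≤ r * s := by
  obtain hs | hs := le_total 0 s
  · exact (min_le_left _ _).trans (mul_le_mul_of_nonneg_right hr.1 hs)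
  · exact (min_le_right _ _).trans (mul_le_mul_of_nonpos_right hr.2 hs)

theorem min_mul_corners_le_mul (hr : r ∈ Set.Icc a b) (hs : s ∈ Set.Icc c d) :
    min (min (a * c) (a * d)) (min (b * c) (b * d)) ≤ r * s := by
  have edge (e : K) : min (e * c) (e * d) ≤ e * s := by
    simpa only [mul_comm e] using min_mul_le_mul hs e
  exact (min_le_min (edge a) (edge b)).trans (min_mul_le_mul hr s)

theorem rat_lt_mul_iff {q : ℚ} {r s : ℝ} :
    (q : ℝ) < r * s ↔ ∃ a b c d : ℚ, q < min (min (a * c) (a * d)) (min (b * c) (b * d)) ∧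
      a < r ∧ r < b ∧ c < s ∧ s < d := by
  constructor
  · intro h
    obtain ⟨a, b, c, d, ha, hb, hc, hd, hsub⟩ := exists_rat_rectangle_subset_of_mem_nhds <|
      (isOpen_lt continuous_const continuous_mul).mem_nhds (x := (r, s)) h
    have hab := (ha.trans hb).le
    have hcd := (hc.trans hd).le
    have corner {x y : ℚ} (hx : (x : ℝ) ∈ Set.Icc (a : ℝ) b) (hy : (y : ℝ) ∈ Set.Icc (c : ℝ) d) :
        q < x * y := by
      have h : (q : ℝ) < x * y := hsub (Set.mk_mem_prod hx hy)
      exact_mod_cast h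
    refine ⟨a, b, c, d, ?_, ha, hb, hc, hd⟩
    simp only [lt_min_iff]
    exact ⟨⟨corner ⟨le_rfl, hab⟩ ⟨le_rfl, hcd⟩, corner ⟨le_rfl, hab⟩ ⟨hcd, le_rfl⟩⟩,
      corner ⟨hab, le_rfl⟩ ⟨le_rfl, hcd⟩, corner ⟨hab, le_rfl⟩ ⟨hcd, le_rfl⟩⟩
  · rintro ⟨a, b, c, d, hq, ha, hb, hc, hd⟩
    have h := min_mul_corners_le_mul (Set.mem_Icc.2 ⟨ha.le, hb.le⟩) (Set.mem_Icc.2 ⟨hc.le, hd.le⟩)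
    exact lt_of_lt_of_le (by exact_mod_cast hq) h

theorem mul_lt_rat_iff {q : ℚ} {r s : ℝ} :
    r * s < q ↔ ∃ a b c d : ℚ, max (max (a * c) (a * d)) (max (b * c) (b * d)) < q ∧
      a < r ∧ r < b ∧ c < s ∧ s < d := by
  have h : r * s < q ↔ ((-q : ℚ) : ℝ) < -r * s := by
    rw [Rat.cast_neg, neg_mul, neg_lt_neg_iff]
  rw [h, rat_lt_mul_iff]
  constructor
  · rintro ⟨a, b, c, d, hq, ha, hb, hc, hd⟩
    refine ⟨-b, -a, c, d, ?_, ?_, ?_, hc, hd⟩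
    · simpa [max_neg_neg, min_comm, neg_lt] using hq
    · push_cast; linarith
    · push_cast; linarith
  · rintro ⟨a, b, c, d, hq, ha, hb, hc, hd⟩
    refine ⟨-b, -a, c, d, ?_, ?_, ?_, hc, hd⟩
    · simpa [min_neg_neg, max_comm] using hq
    · push_cast; linarith
    · push_cast; linarith

theorem rat_lt_add_iff {q : ℚ} {r s : ℝ} :
    (q : ℝ) < r + s ↔ ∃ t : ℚ, t < r ∧ ((q - t : ℚ) : ℝ) < s := by
  push_cast
  refine ⟨fun h => ?_, fun ⟨t, ht, hqt⟩ => by linarith⟩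
  obtain ⟨t, hqt, htr⟩ := exists_rat_btwn (sub_lt_iff_lt_add.2 h)
  exact ⟨t, htr, by linarith⟩

theorem add_lt_rat_iff {q : ℚ} {r s : ℝ} :
    r + s < q ↔ ∃ t : ℚ, r < t ∧ s < ((q - t : ℚ) : ℝ) := by
  push_cast
  refine ⟨fun h => ?_, fun ⟨t, ht, hqt⟩ => by linarith⟩
  obtain ⟨t, hrt, htq⟩ := exists_rat_btwn (lt_sub_iff_add_lt.2 h)
  exact ⟨t, hrt, by linarith⟩

end RationalRectangle

section Points

variable {T : Type} [TopologicalSpace T] {w : T}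

theorem le_himp_iff_forall_mem {V a b : Opens T} :
    V ≤ a ⇨ b ↔ ∀ w ∈ V, w ∈ a → w ∈ b := by
  rw [le_himp_iff]
  exact ⟨fun h w hV ha => h ⟨hV, ha⟩, fun h w hw => h w hw.1 hw.2⟩

theorem le_bihimp_iff_forall_mem {V a b : Opens T} :
    V ≤ bihimp a b ↔ ∀ w ∈ V, (w ∈ a ↔ w ∈ b) := by
  rw [bihimp_def, le_inf_iff, le_himp_iff_forall_mem, le_himp_iff_forall_mem]
  exact ⟨fun h w hV => ⟨h.2 w hV, h.1 w hV⟩,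
    fun h => ⟨fun w hV => (h w hV).2, fun w hV => (h w hV).1⟩⟩

theorem le_compl_iff_forall_notMem {V a : Opens T} : V ≤ aᶜ ↔ ∀ w ∈ V, w ∉ a := by
  rw [← himp_bot, le_himp_iff_forall_mem]
  rfl

theorem le_iSup_iff_forall_mem {ι : Sort*} {V : Opens T} {f : ι → Opens T} :
    V ≤ ⨆ i, f i ↔ ∀ w ∈ V, ∃ i, w ∈ f i := by
  simp only [← Opens.mem_iSup]
  rfl

theorem le_isCut_iff {V : Opens T} {L U : Name (Opens T)} :
    V ≤ IsCut L U ↔ V ≤ sub L ratSet ∧ V ≤ sub U ratSet ∧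
      ∀ w ∈ V, IsDedekindCut {q | w ∈ mem (rat q) L} {q | w ∈ mem (rat q) U} := by
  simp only [IsCut, le_inf_iff, le_iInf_iff, le_bihimp_iff_forall_mem, le_compl_iff_forall_notMem,
    le_iSup_iff_forall_mem, and_assoc, Opens.mem_inf, Opens.mem_iSup, exists_prop]
  refine and_congr_right fun _ => and_congr_right fun _ => ⟨?_, fun h => ?_⟩
  · rintro ⟨hL, hU, roundL, roundU, disj, loc⟩ w hw
    exact ⟨hL w hw, hU w hw, fun q => roundL q w hw, fun q => roundU q w hw,
      Set.disjoint_left.2 fun q hqL hqU => disj q w hw ⟨hqL, hqU⟩, fun q r hqr => loc q r hqr hw⟩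
  · exact ⟨fun w hw => (h w hw).nonempty_lower, fun w hw => (h w hw).nonempty_upper,
      fun q w hw => (h w hw).mem_lower_iff q, fun q w hw => (h w hw).mem_upper_iff q,
      fun q w hw hq => Set.disjoint_left.1 (h w hw).disjoint hq.1 hq.2,
      fun q r hqr w hw => (h w hw).located q r hqr⟩

/-- The real number `x` of the model takes the value `r` at the point `w`. -/
def IsRealValue (w : T) (x : Name (Opens T)) (r : ℝ) : Prop :=
  ∀ q : ℚ, (w ∈ lo x q ↔ q < r) ∧ (w ∈ up x q ↔ r < q)

/-- The complex number `z` of the model takes the value `c` at the point `w`. -/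
def IsComplexValue (w : T) (z : Name (Opens T)) (c : ℂ) : Prop :=
  IsRealValue w (re z) c.re ∧ IsRealValue w (im z) c.im

theorem mem_eq_congr_left {a b : Name (Opens T)} (h : w ∈ eq a b) (c : Name (Opens T)) :
    w ∈ eq a c ↔ w ∈ eq b c :=
  ⟨fun hac => TopModel.eq_trans b a c ⟨(TopModel.eq_comm a b).le h, hac⟩,
    fun hbc => TopModel.eq_trans a b c ⟨h, hbc⟩⟩

variable {x y z z' : Name (Opens T)} {r s : ℝ} {c d : ℂ}

theorem IsRealValue.congr (h : w ∈ eq x y) (hx : IsRealValue w x r) : IsRealValue w y r := by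
  simpa only [IsRealValue, lo, up, Opens.mem_iSup, Opens.mem_inf, mem_eq_congr_left h] using hx

theorem IsRealValue.unique (hr : IsRealValue w x r) (hs : IsRealValue w x s) : r = s :=
  le_antisymm (le_of_forall_rat_lt_imp_le fun q hq => ((hs q).1.1 ((hr q).1.2 hq)).le)
    (le_of_forall_rat_lt_imp_le fun q hq => ((hr q).1.1 ((hs q).1.2 hq)).le)

theorem isRealValue_cut {φ ψ : ℚ → Opens T} :
    IsRealValue w (cut φ ψ) r ↔ ∀ q : ℚ, (w ∈ φ q ↔ q < r) ∧ (w ∈ ψ q ↔ r < q) := by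
  simp only [IsRealValue, lo_cut, up_cut]

theorem exists_isRealValue (h : w ∈ IsReal x) : ∃ r, IsRealValue w x r := by
  simp only [IsReal, Opens.mem_iSup, Opens.mem_inf] at h
  obtain ⟨L, U, hx, hLU⟩ := h
  obtain ⟨r, hr⟩ := ((le_isCut_iff.1 le_rfl).2.2 w hLU).exists_real
  have hopair : IsRealValue w (opair L U) r := fun q => by
    rw [lo_opair, up_opair]
    exact hr q
  exact ⟨r, hopair.congr ((TopModel.eq_comm x _).le hx)⟩

theorem le_isReal_cut {V : Opens T} {φ ψ : ℚ → Opens T}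
    (h : ∀ w ∈ V, ∃ r, IsRealValue w (cut φ ψ) r) : V ≤ IsReal (cut φ ψ) := by
  refine le_iSup₂_of_le (sepRat φ) (sepRat ψ) (le_inf ?_ (le_isCut_iff.2 ⟨?_, ?_, fun w hw => ?_⟩))
  · exact le_top.trans (TopModel.eq_self _).ge
  · exact le_top.trans (sub_sepRat_ratSet φ).ge
  · exact le_top.trans (sub_sepRat_ratSet ψ).ge
  · obtain ⟨r, hr⟩ := h w hw
    simp only [mem_rat_sepRat]
    exact isDedekindCut_of_real (fun q => (isRealValue_cut.1 hr q).1)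
      fun q => (isRealValue_cut.1 hr q).2

theorem isRealValue_constR (r : ℝ) : IsRealValue w (constR r) r := by
  simp only [constR, isRealValue_cut, Opens.mem_iSup, Opens.mem_top, exists_prop, and_true,
    implies_true]

theorem IsRealValue.negR (hx : IsRealValue w x r) : IsRealValue w (negR x) (-r) := by
  refine isRealValue_cut.2 fun q => ?_
  rw [(hx (-q)).1, (hx (-q)).2, Rat.cast_neg]
  exact ⟨lt_neg, neg_lt⟩

theorem IsRealValue.addR (hx : IsRealValue w x r) (hy : IsRealValue w y s) :
    IsRealValue w (addR x y) (r + s) := by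
  refine isRealValue_cut.2 fun q => ?_
  simp only [Opens.mem_iSup, Opens.mem_inf, hx _, hy _]
  exact ⟨rat_lt_add_iff.symm, add_lt_rat_iff.symm⟩

theorem IsRealValue.mulR (hx : IsRealValue w x r) (hy : IsRealValue w y s) :
    IsRealValue w (mulR x y) (r * s) := by
  refine isRealValue_cut.2 fun q => ?_
  simp only [Opens.mem_iSup, Opens.mem_inf, hx _, hy _, exists_prop, and_assoc]
  exact ⟨rat_lt_mul_iff.symm, mul_lt_rat_iff.symm⟩

theorem isComplexValue_opair :
    IsComplexValue w (opair x y) c ↔ IsRealValue w x c.re ∧ IsRealValue w y c.im := by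
  simp only [IsComplexValue, IsRealValue, lo_re_opair, up_re_opair, lo_im_opair, up_im_opair]

theorem IsComplexValue.congr (h : w ∈ eq z z') (hz : IsComplexValue w z c) :
    IsComplexValue w z' c := by
  simpa only [IsComplexValue, re, im, isRealValue_cut, Opens.mem_iSup, Opens.mem_inf,
    mem_eq_congr_left h] using hz

theorem IsComplexValue.unique (hc : IsComplexValue w z c) (hd : IsComplexValue w z d) : c = d :=
  Complex.ext (hc.1.unique hd.1) (hc.2.unique hd.2)

theorem exists_isComplexValue (h : w ∈ IsComplex z) : ∃ c, IsComplexValue w z c := by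
  simp only [IsComplex, Opens.mem_iSup, Opens.mem_inf] at h
  obtain ⟨x, y, ⟨hz, hx⟩, hy⟩ := h
  obtain ⟨r, hr⟩ := exists_isRealValue hx
  obtain ⟨s, hs⟩ := exists_isRealValue hy
  have hopair : IsComplexValue w (opair x y) ⟨r, s⟩ := isComplexValue_opair.2 ⟨hr, hs⟩
  exact ⟨⟨r, s⟩, hopair.congr ((TopModel.eq_comm z _).le hz)⟩

theorem le_isComplex_opair_cut {V : Opens T} {φ ψ φ' ψ' : ℚ → Opens T}
    (h : ∀ w ∈ V, ∃ c, IsComplexValue w (opair (cut φ ψ) (cut φ' ψ')) c) :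
    V ≤ IsComplex (opair (cut φ ψ) (cut φ' ψ')) := by
  simp only [isComplexValue_opair] at h
  exact le_isComplex_opair (le_isReal_cut fun w hw => (h w hw).imp' _ fun _ hc => hc.1)
    (le_isReal_cut fun w hw => (h w hw).imp' _ fun _ hc => hc.2)

theorem isComplexValue_constC (c : ℂ) : IsComplexValue w (constC c) c :=
  isComplexValue_opair.2 ⟨isRealValue_constR c.re, isRealValue_constR c.im⟩

theorem IsComplexValue.negC (hz : IsComplexValue w z c) : IsComplexValue w (negC z) (-c) :=
  isComplexValue_opair.2 ⟨hz.1.negR, hz.2.negR⟩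

theorem IsComplexValue.addC (hz : IsComplexValue w z c) (hz' : IsComplexValue w z' d) :
    IsComplexValue w (addC z z') (c + d) :=
  isComplexValue_opair.2 ⟨hz.1.addR hz'.1, hz.2.addR hz'.2⟩

theorem IsComplexValue.mulC (hz : IsComplexValue w z c) (hz' : IsComplexValue w z' d) :
    IsComplexValue w (mulC z z') (c * d) := by
  refine isComplexValue_opair.2 ⟨?_, (hz.1.mulR hz'.2).addR (hz.2.mulR hz'.1)⟩
  rw [Complex.mul_re, sub_eq_add_neg]
  exact (hz.1.mulR hz'.1).addR (hz.2.mulR hz'.2).negR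

theorem IsComplexValue.powC (hz : IsComplexValue w z c) (k : ℕ) :
    IsComplexValue w (powC z k) (c ^ k) := by
  induction k with
  | zero =>
    rw [pow_zero]
    exact isComplexValue_constC 1
  | succ k ih =>
    rw [pow_succ]
    exact ih.mulC hz

theorem IsComplexValue.sumC {m : ℕ} {a : ℕ → Name (Opens T)} {α : Fin m → ℂ}
    (ha : ∀ k : Fin m, IsComplexValue w (a k) (α k)) (hz : IsComplexValue w z c) :
    IsComplexValue w (sumC a z m) (∑ k, α k * c ^ (k : ℕ)) := by
  induction m with
  | zero => exact isComplexValue_constC 0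
  | succ m ih =>
    rw [Fin.sum_univ_castSucc]
    exact (ih fun k => ha k.castSucc).addC ((ha (Fin.last m)).mulC (hz.powC m))

theorem isComplex_constC (c : ℂ) : IsComplex (constC c : Name (Opens T)) = ⊤ :=
  top_le_iff.1 <| le_isComplex_opair_cut fun _ _ => ⟨c, isComplexValue_constC c⟩

theorem isComplex_le_isComplex_negC (z : Name (Opens T)) : IsComplex z ≤ IsComplex (negC z) :=
  le_isComplex_opair_cut fun _ hw => (exists_isComplexValue hw).imp' _ fun _ hc => hc.negC

theorem isComplex_inf_isComplex_le_isComplex_addC (z z' : Name (Opens T)) :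
    IsComplex z ⊓ IsComplex z' ≤ IsComplex (addC z z') :=
  le_isComplex_opair_cut fun _ hw =>
    (exists_isComplexValue hw.1).elim fun _ hc =>
      (exists_isComplexValue hw.2).imp' _ fun _ hd => hc.addC hd

theorem IsComplexValue.mem_memOpen_iff {O : Opens ℂ} (hz : IsComplexValue w z c) :
    w ∈ memOpen z O ↔ c ∈ O := by
  simp only [memOpen, Opens.mem_iSup, Opens.mem_inf, hz.1 _, hz.2 _, exists_prop, and_assoc]
  refine ⟨fun ⟨_, _, _, _, hO, ha, hb, hc, hd⟩ => hO c ha hb hc hd, fun h => ?_⟩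
  obtain ⟨a, b, c', d, ha, hb, hc, hd, hsub⟩ := exists_rat_rectangle_subset_of_mem_nhds <|
    (O.isOpen.preimage Complex.equivRealProdCLM.symm.continuous).mem_nhds (x := (c.re, c.im)) h
  exact ⟨a, b, c', d, fun u hau hub hcu hud =>
    hsub (Set.mk_mem_prod ⟨hau.le, hub.le⟩ ⟨hcu.le, hud.le⟩), ha, hb, hc, hd⟩

theorem isComplex_le_isMonicPoly_sqSub (z : Name (Opens T)) :
    IsComplex z ≤ IsMonicPoly 2 (sqSub z) := by
  refine le_inf ((le_iInf fun k => ?_).trans (iInf_isComplex_le_isPoly_poly _))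
    (le_top.trans_eq ?_)
  · fin_cases k
    · exact isComplex_le_isComplex_negC z
    · exact le_top.trans (isComplex_constC 0).ge
    · exact le_top.trans (isComplex_constC 1).ge
  · exact ((mem_opair_nat_poly ![negC z, constC 0, constC 1] 2 _).trans (TopModel.eq_self _)).symm

theorem sum_eq_zero_of_mem_isRoot_poly {n : ℕ} {a : Fin (n + 1) → Name (Opens T)}
    {α : Fin (n + 1) → ℂ} (ha : ∀ k, IsComplexValue w (a k) (α k)) (hz : IsComplexValue w z c)
    (h : w ∈ IsRoot n (poly a) z) : ∑ k, α k * c ^ (k : ℕ) = 0 := by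
  simp only [IsRoot, Opens.mem_iSup, Opens.mem_inf, mem_opair_nat_poly] at h
  obtain ⟨b, hb, hzero⟩ := h
  have hbα (k : Fin (n + 1)) : IsComplexValue w (b k) (α k) :=
    (ha k).congr <| (TopModel.eq_comm (b k) _).le <|
      iInf_le (fun k : Fin (n + 1) => eq (b k) (a k)) k hb
  exact ((IsComplexValue.sumC hbα hz).congr hzero).unique (isComplexValue_constC 0)

theorem continuousOn_of_isRealValue {V : Set T} {f : T → ℝ} (h : ∀ w ∈ V, IsRealValue w x (f w)) :
    ContinuousOn f V := by
  refine fun w hw => tendsto_order.2 ⟨fun b hb => ?_, fun b hb => ?_⟩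
  · obtain ⟨q, hbq, hqw⟩ := exists_rat_btwn hb
    have hlo : ∀ᶠ u in 𝓝 w, u ∈ lo x q := (lo x q).isOpen.mem_nhds ((h w hw q).1.2 hqw)
    filter_upwards [hlo.filter_mono nhdsWithin_le_nhds, self_mem_nhdsWithin] with u hu huV
    exact hbq.trans ((h u huV q).1.1 hu)
  · obtain ⟨q, hwq, hqb⟩ := exists_rat_btwn hb
    have hup : ∀ᶠ u in 𝓝 w, u ∈ up x q := (up x q).isOpen.mem_nhds ((h w hw q).2.2 hwq)
    filter_upwards [hup.filter_mono nhdsWithin_le_nhds, self_mem_nhdsWithin] with u hu huV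
    exact ((h u huV q).2.1 hu).trans hqb

theorem continuousOn_of_isComplexValue {V : Set T} {f : T → ℂ}
    (h : ∀ w ∈ V, IsComplexValue w z (f w)) : ContinuousOn f V := by
  have hre : ContinuousOn (fun w => (f w).re) V :=
    continuousOn_of_isRealValue fun w hw => (h w hw).1
  have him : ContinuousOn (fun w => (f w).im) V :=
    continuousOn_of_isRealValue fun w hw => (h w hw).2
  exact Complex.equivRealProdCLM.symm.continuous.comp_continuousOn (hre.prodMk him)

theorem exists_continuousOn_of_mem_hasRoot_poly {n : ℕ} {a : Fin (n + 1) → Name (Opens T)}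
    {α : T → Fin (n + 1) → ℂ} (ha : ∀ w k, IsComplexValue w (a k) (α w k)) {v : T}
    (hv : v ∈ HasRoot n (poly a)) :
    ∃ V ∈ 𝓝 v, ∃ f : T → ℂ, ContinuousOn f V ∧ ∀ w ∈ V, ∑ k, α w k * f w ^ (k : ℕ) = 0 := by
  obtain ⟨z, hz⟩ := Opens.mem_iSup.1 hv
  have hval (w : T) : ∃ c, w ∈ IsComplex z → IsComplexValue w z c :=
    by
    by_cases hw : w ∈ IsComplex z
    · exact (exists_isComplexValue hw).imp fun _ hc _ => hc
    · exact ⟨0, fun h => absurd h hw⟩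
  choose f hf using hval
  exact ⟨_, (IsComplex z ⊓ IsRoot n (poly a) z).isOpen.mem_nhds hz, f,
    continuousOn_of_isComplexValue fun w hw => hf w hw.1,
    fun w hw => sum_eq_zero_of_mem_isRoot_poly (ha w) (hf w hw.1) hw.2⟩

end Points

section SquareRoot

theorem not_exists_continuousOn_sphere_sq_eq_sub (v : ℂ) {r : ℝ} (hr : 0 < r) :
    ¬ ∃ f : ℂ → ℂ, ContinuousOn f (Metric.sphere v r) ∧
      ∀ w ∈ Metric.sphere v r, f w ^ 2 = w - v := by
  rintro ⟨f, hf, hsq⟩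
  let g : ℝ → ℂ := fun θ => √r * Complex.exp (θ * Complex.I)
  have hg : Continuous g := by fun_prop
  have hg0 (θ : ℝ) : g θ ≠ 0 :=
    mul_ne_zero (Complex.ofReal_ne_zero.2 (Real.sqrt_ne_zero'.2 hr)) (Complex.exp_ne_zero _)
  -- `g π = -g 0` although `g π ^ 2 = g 0 ^ 2`, so neither `g` nor `-g` factors through the sphere.
  have hgπ : g Real.pi = -g 0 := by simp [g, Complex.exp_pi_mul_I]
  have hgr (θ : ℝ) : v + g θ ^ 2 ∈ Metric.sphere v r := by
    simp [g, Complex.norm_exp_ofReal_mul_I, hr.le]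
  let F : ℝ → ℂ := fun θ => f (v + g θ ^ 2)
  have hF : Continuous F := hf.comp_continuous (by fun_prop) hgr
  have hFπ : F Real.pi = F 0 := by simp only [F, hgπ, neg_sq]
  have hFg : F = g ∨ F = -g := by
    simpa only [Set.eqOn_univ] using isPreconnected_univ.eq_or_eq_neg_of_sq_eq hF.continuousOn
      hg.continuousOn (fun θ _ => by simp [F, hsq _ (hgr θ)]) fun {θ} _ => hg0 θ
  have hg0π : g Real.pi = g 0 := by
    obtain h | h := hFg
    · rwa [h] at hFπ
    · rwa [h, Pi.neg_apply, Pi.neg_apply, neg_inj] at hFπ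
  exact hg0 0 (self_eq_neg.1 (hg0π.symm.trans hgπ))

theorem not_exists_continuousOn_sq_eq_sub {V : Set ℂ} {v : ℂ} (hV : V ∈ 𝓝 v) :
    ¬ ∃ f : ℂ → ℂ, ContinuousOn f V ∧ ∀ w ∈ V, f w ^ 2 = w - v := by
  rintro ⟨f, hf, hsq⟩
  obtain ⟨r, hr, hball⟩ := Metric.nhds_basis_closedBall.mem_iff.1 hV
  have hsphere := Metric.sphere_subset_closedBall.trans hball
  exact not_exists_continuousOn_sphere_sq_eq_sub v hr
    ⟨f, hf.mono hsphere, fun w hw => hsq w (hsphere hw)⟩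

end SquareRoot

section Generic

theorem notMem_hasRoot_sqSub {z : Name (Opens ℂ)} {v : ℂ}
    (hz : ∀ w, IsComplexValue w z (w - v)) : v ∉ HasRoot 2 (sqSub z) := by
  intro hv
  have ha (w : ℂ) (k : Fin 3) :
      IsComplexValue w (![negC z, constC 0, constC 1] k) (![-(w - v), 0, 1] k) := by
    fin_cases k
    · exact (hz w).negC
    · exact isComplexValue_constC 0
    · exact isComplexValue_constC 1
  obtain ⟨V, hV, f, hf, hroot⟩ := exists_continuousOn_of_mem_hasRoot_poly ha hv
  refine not_exists_continuousOn_sq_eq_sub hV ⟨f, hf, fun w hw => ?_⟩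
  have hsum : -(w - v) * f w ^ 0 + 0 * f w ^ 1 + 1 * f w ^ 2 = 0 :=
    (Fin.sum_univ_three _).symm.trans (hroot w hw)
  linear_combination hsum

theorem isComplexValue_generic (w : ℂ) : IsComplexValue w generic w :=
  isComplexValue_opair.2 ⟨isRealValue_cut.2 fun _ => ⟨Iff.rfl, Iff.rfl⟩,
    isRealValue_cut.2 fun _ => ⟨Iff.rfl, Iff.rfl⟩⟩

theorem isComplex_generic : IsComplex generic = ⊤ :=
  top_le_iff.1 <| le_isComplex_opair_cut fun w _ => ⟨w, isComplexValue_generic w⟩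

theorem isComplexValue_generic_sub (v w : ℂ) :
    IsComplexValue w (addC generic (negC (constC v))) (w - v) := by
  rw [sub_eq_add_neg]
  exact (isComplexValue_generic w).addC (isComplexValue_constC v).negC

theorem isComplex_generic_sub (v : ℂ) : IsComplex (addC generic (negC (constC v))) = ⊤ :=
  top_le_iff.1 <| (le_inf isComplex_generic.ge <|
    (isComplex_constC v).ge.trans (isComplex_le_isComplex_negC _)).trans <|
      isComplex_inf_isComplex_le_isComplex_addC _ _

theorem everyPolyHasRoot_eq_bot : EveryPolyHasRoot (Opens ℂ) = ⊥ := by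
  refine eq_bot_iff.2 fun v hv => ?_
  have hmonic := isComplex_le_isMonicPoly_sqSub (addC generic (negC (constC v)))
  rw [isComplex_generic_sub, top_le_iff] at hmonic
  have hroot := everyPolyHasRoot_le_himp one_le_two (sqSub (addC generic (negC (constC v))))
  rw [hmonic, top_himp] at hroot
  exact (notMem_hasRoot_sqSub (isComplexValue_generic_sub v) (hroot hv)).elim

end Generic

end TopModel

theorem theorem6 :
    -- the whole space forces that not every (monic, nonconstant) polynomial has a root
    ((⊤ : Opens ℂ) ⊩ (EveryPolyHasRoot (Opens ℂ))ᶜ) ∧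
    -- no non-empty open set forces that every polynomial has a root
    (∀ U : Opens ℂ, U ≠ ⊥ → ¬ (U ⊩ EveryPolyHasRoot (Opens ℂ))) ∧
    -- `G` is a complex number, characterized by `O ⊩ G ∈ O`
    (((⊤ : Opens ℂ) ⊩ IsComplex generic) ∧ ∀ O : Opens ℂ, O ⊩ memOpen generic O) ∧
    -- no neighbourhood of `0` forces that `X ^ 2 - G` has a root
    (((⊤ : Opens ℂ) ⊩ IsMonicPoly 2 (sqSub generic)) ∧
      ∀ U : Opens ℂ, (0 : ℂ) ∈ U → ¬ (U ⊩ HasRoot 2 (sqSub generic))) ∧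
    -- no neighbourhood of `v` forces that `X ^ 2 - (G - v)` has a root
    (∀ v : ℂ, ((⊤ : Opens ℂ) ⊩ IsMonicPoly 2 (sqSub (addC generic (negC (constC v))))) ∧
      ∀ U : Opens ℂ, v ∈ U →
        ¬ (U ⊩ HasRoot 2 (sqSub (addC generic (negC (constC v)))))) := by
  refine ⟨?_, fun U hU h => ?_, ⟨isComplex_generic.ge, fun O w hw => ?_⟩,
    ⟨?_, fun U hU h => ?_⟩, fun v => ⟨?_, fun U hU h => ?_⟩⟩
  · rw [everyPolyHasRoot_eq_bot, compl_bot]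
    exact le_rfl
  · exact hU (le_bot_iff.1 (everyPolyHasRoot_eq_bot ▸ h))
  · exact (isComplexValue_generic w).mem_memOpen_iff.2 hw
  · exact isComplex_generic.ge.trans (isComplex_le_isMonicPoly_sqSub generic)
  · exact notMem_hasRoot_sqSub (fun w => by simpa using isComplexValue_generic w) (h hU)
  · exact (isComplex_generic_sub v).ge.trans (isComplex_le_isMonicPoly_sqSub _)
  · exact notMem_hasRoot_sqSub (isComplexValue_generic_sub v) (h hU)
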